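/- Let $D\ge 1$ be an integer. Put $$c_i=\frac{3(D-i+1)\,i\,(D+i+1)}{D(D+2)(2i+1)}\ (1\le i\le D),\qquad a_i=\frac{3i(i+1)}{D(D+2)}\ (0\le i\le D),\qquad b_i=\frac{3(D-i)(i+1)(D+i+2)}{D(D+2)(2i+1)}\ (0\le i\le D-1),$$ and let $A$ be the real tridiagonal $(D+1)\times(D+1)$ matrix, with rows and columns indexed by $0,1,\dots,D$, whose entries are $A_{i,i}=a_i$, $A_{i,i+1}=b_i$, $A_{i,i-1}=c_i$. Define polynomials $u_0,\dots,u_D\in\mathbb R[\lambda]$ by $u_0=1$, $u_1=\lambda/3$ and $\lambda u_i=b_iu_{i+1}+a_iu_i+c_iu_{i-1}$ for $1\le i\le D-1$. Let $k_i=\dfrac{b_0b_1\cdots b_{i-1}}{c_1c_2\cdots c_i}$, $v_i=k_iu_i$ and $B_i=v_i(A)$ for $0\le i\le D$, and let $p^h_{i,j}=(B_i)_{h,j}$ be the $(h,j)$-entry of $B_i$ for $0\le h,i,j\le D$. A triple $(a,b,c)$ of elements of $\tfrac12\mathbb N$ (where $\mathbb N=\{0,1,2,\dots\}$) is called admissible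 if $a+b+c\in\mathbb N$ and $a\le b+c$, $b\le c+a$, $c\le a+b$; in that case let $$\Delta(a,b,c)=\left(\frac{(a+b-c)!\,(b+c-a)!\,(c+a-b)!}{(a+b+c+1)!}\right)^{1/2}.$$ For $a,b,c,d,e,f\in\tfrac12\mathbb N$ the Racah coefficient $W(a,b,c,d;e,f)$ is $0$ unless $(a,b,e)$, $(c,d,e)$, $(a,c,f)$, $(b,d,f)$ are all admissible, in which case $$W(a,b,c,d;e,f)=\frac{\Delta(a,b,e)\Delta(c,d,e)\Delta(a,c,f)\Delta(b,d,f)\,(\beta_1+1)!\,(-1)^{\beta_1-(a+b+c+d)}}{(\beta_2-\beta_1)!(\beta_3-\beta_1)!(\beta_1-\alpha_1)!(\beta_1-\alpha_2)!(\beta_1-\alpha_3)!(\beta_1-\alpha_4)!}\;{}_4F_3\!\left[\begin{matrix}\alpha_1-\beta_1,\ \alpha_2-\beta_1,\ \alpha_3-\beta_1,\ \alpha_4-\beta_1\\ -\beta_1-1,\ \beta_2-\beta_1+1,\ \beta_3-\beta_1+1\end{matrix};1\right],$$ where $(\alpha_1,\alpha_2,\alpha_3,\alpha_4)=(a+b+e,\;c+d+e,\;a+c+f,\;b+d+f)$,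 $\beta_1$ is the smallest of $a+b+c+d,\ a+d+e+f,\ b+c+e+f$, and $\beta_2,\beta_3$ are the other two of these three values in either order. Here ${}_4F_3$ is the usual hypergeometric series $$\sum_{n\ge0}\frac{(a_1)_n(a_2)_n(a_3)_n(a_4)_n}{(b_1)_n(b_2)_n(b_3)_n}\frac{z^n}{n!},\qquad (x)_n=x(x+1)\cdots(x+n-1),$$ evaluated at $z=1$; it terminates (all terms after the first vanishing numerator are taken to be $0$). Then for all integers $0\le h,i,j\le D$, $$p^h_{i,j}=(2i+1)(2j+1)(D+1)\,\Bigl(W\bigl(\tfrac D2,\tfrac D2,i,h;j,\tfrac D2\bigr)\Bigr)^2 .$$ Hence all entries of every matrix $B_i$ $(0\le i\le D)$ are nonnegative. -/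

import Mathlib

open Polynomial

noncomputable section

namespace KreschTamvakis

/-! ### The matrix `A` and the polynomials `u_i`, `v_i` -/

/-- `c_i = 3 (D-i+1) i (D+i+1) / (D (D+2) (2i+1))`, used for `1 ≤ i ≤ D`. -/
def c (D i : ℕ) : ℝ :=
  3 * ((D : ℝ) - i + 1) * i * (D + i + 1) / (D * (D + 2) * (2 * i + 1))

/-- `a_i = 3 i (i+1) / (D (D+2))`, used for `0 ≤ i ≤ D`. -/
def a (D i : ℕ) : ℝ :=
  3 * (i : ℝ) * (i + 1) / (D * (D + 2))

/-- `b_i = 3 (D-i) (i+1) (D+i+2) / (D (D+2) (2i+1))`, used for `0 ≤ i ≤ D-1`. -/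
def b (D i : ℕ) : ℝ :=
  3 * ((D : ℝ) - i) * (i + 1) * (D + i + 2) / (D * (D + 2) * (2 * i + 1))

/-- The tridiagonal matrix `A`, rows and columns indexed by `0, 1, …, D`:
`A_{i,i} = a_i`, `A_{i,i+1} = b_i`, `A_{i,i-1} = c_i`, and all other entries are zero. -/
def A (D : ℕ) : Matrix (Fin (D + 1)) (Fin (D + 1)) ℝ :=
  Matrix.of fun i j =>
    if (j : ℕ) = i then a D i
    else if (j : ℕ) = i + 1 then b D i
    else if (j : ℕ) + 1 = i then c D i
    else 0

/-- The polynomials `u_i` determined by `u_0 = 1`, `u_1 = λ/3` and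
`λ u_i = b_i u_{i+1} + a_i u_i + c_i u_{i-1}` for `1 ≤ i ≤ D-1` (there `b_i ≠ 0`).
Only `u_0, …, u_D` are meaningful. -/
def u (D : ℕ) : ℕ → ℝ[X]
  | 0 => 1
  | 1 => C (1 / 3) * X
  | n + 2 => C (b D (n + 1))⁻¹ *
      (X * u D (n + 1) - C (a D (n + 1)) * u D (n + 1) - C (c D (n + 1)) * u D n)

/-- `k_i = (b_0 b_1 ⋯ b_{i-1}) / (c_1 c_2 ⋯ c_i)`. -/
def k (D i : ℕ) : ℝ :=
  (∏ m ∈ Finset.range i, b D m) / ∏ m ∈ Finset.Icc 1 i, c D m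

/-- `v_i = k_i u_i`. -/
def v (D i : ℕ) : ℝ[X] := C (k D i) * u D i

/-- `B_i = v_i(A)`. -/
def B (D : ℕ) (i : Fin (D + 1)) : Matrix (Fin (D + 1)) (Fin (D + 1)) ℝ :=
  aeval (A D) (v D i)

/-- `p^h_{i,j}` is the `(h,j)`-entry of `B_i`. -/
def p (D : ℕ) (h i j : Fin (D + 1)) : ℝ := B D i h j

/-! ### Racah coefficients -/

/-- The Pochhammer symbol `(x)_n = x (x+1) ⋯ (x+n-1)`. -/
def poch (x : ℝ) (n : ℕ) : ℝ := ∏ m ∈ Finset.range n, (x + m)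

/-- The hypergeometric series `₄F₃[a₁, a₂, a₃, a₄; b₁, b₂, b₃; z]`. It is only used where an upper
parameter is a nonpositive integer and no denominator vanishes before the series terminates; all
later summands are zero. -/
def hyp4F3 (a₁ a₂ a₃ a₄ b₁ b₂ b₃ z : ℝ) : ℝ :=
  ∑' n : ℕ, poch a₁ n * poch a₂ n * poch a₃ n * poch a₄ n / (poch b₁ n * poch b₂ n * poch b₃ n)
    * (z ^ n / (n.factorial : ℝ))

/-- The factorial of a real number that is a natural number. -/
def fact (x : ℝ) : ℝ := (Nat.factorial ⌊x⌋₊ : ℝ)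

/-- `x ∈ ½ℕ`. -/
def IsHalfNat (x : ℝ) : Prop := ∃ n : ℕ, x = (n : ℝ) / 2

/-- Admissible triples: `x, y, z ∈ ½ℕ` with `x + y + z ∈ ℕ`, satisfying the triangle
inequalities. -/
def Admissible (x y z : ℝ) : Prop :=
  (IsHalfNat x ∧ IsHalfNat y ∧ IsHalfNat z) ∧ (∃ n : ℕ, x + y + z = (n : ℝ)) ∧
    x ≤ y + z ∧ y ≤ z + x ∧ z ≤ x + y

/-- The triangle coefficient `Δ(x,y,z)`, used for admissible triples, where the arguments of all
four factorials are natural numbers. -/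
def triangleCoeff (x y z : ℝ) : ℝ :=
  Real.sqrt (fact (x + y - z) * fact (y + z - x) * fact (z + x - y) / fact (x + y + z + 1))

/-- The part of the Racah coefficient that depends on `α₁, …, α₄`, `β₁, β₂, β₃` and
`s = a + b + c + d`, where `β₁` is the smallest of the `β`'s. The formula is symmetric in the `α`'s
and in `β₂, β₃`. The exponent `β₁ - s` is an integer in all admissible cases. -/
def racahSeries (α₁ α₂ α₃ α₄ β₁ β₂ β₃ s : ℝ) : ℝ :=
  fact (β₁ + 1) * (-1 : ℝ) ^ (⌊β₁ - s⌋ : ℤ) /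
      (fact (β₂ - β₁) * fact (β₃ - β₁) *
        fact (β₁ - α₁) * fact (β₁ - α₂) * fact (β₁ - α₃) * fact (β₁ - α₄)) *
    hyp4F3 (α₁ - β₁) (α₂ - β₁) (α₃ - β₁) (α₄ - β₁)
      (-β₁ - 1) (β₂ - β₁ + 1) (β₃ - β₁ + 1) 1

open Classical in
/-- The Racah coefficient `W(a,b,c,d;e,f)`: zero unless the four triples are all admissible.
Among `x = a+b+c+d`, `y = a+d+e+f`, `z = b+c+e+f`, a smallest value is taken as `β₁`, and the
other two are `β₂, β₃`. -/
def W (a b c d e f : ℝ) : ℝ :=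
  if Admissible a b e ∧ Admissible c d e ∧ Admissible a c f ∧ Admissible b d f then
    let x := a + b + c + d
    let y := a + d + e + f
    let z := b + c + e + f
    let R := fun β₁ β₂ β₃ : ℝ =>
      racahSeries (a + b + e) (c + d + e) (a + c + f) (b + d + f) β₁ β₂ β₃ x
    triangleCoeff a b e * triangleCoeff c d e * triangleCoeff a c f * triangleCoeff b d f *
      (if x ≤ y ∧ x ≤ z then R x y z else if y ≤ z then R y x z else R z x y)
  else 0

end KreschTamvakis

end

/-!
For fixed `D`, write `S(h,i,j)` for the square of the `6j`-symbol `{h i j; D/2 D/2 D/2}`, which is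
`W(D/2, D/2, i, h; j, D/2)²` (`W_sq`). Since `k_i = 2i+1` (`k_eq`), the theorem says that the
`(h,j)`-entry of `u_i(A)` is `(2j+1)(D+1) S(h,i,j)`. The matrices `u_i(A)` are determined by
`u_0(A) = 1` and `b_i u_{i+1}(A) = A u_i(A) - a_i u_i(A) - c_i u_{i-1}(A)`. Multiplication by `A` on the
left acts on the row index `h` by the same coefficients `a_h, b_h, c_h`, so everything comes down to
a difference equation that treats `h` and `i` alike (`racahOp_sixjSq`):

  `b_h S(h+1,i,j) + a_h S(h,i,j) + c_h S(h-1,i,j) = b_i S(h,i+1,j) + a_i S(h,i,j) + c_i S(h,i-1,j)`.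

To prove it, `S` is written as an explicit weight, a product of factorials, times the square of
Racah's single sum `∑ (-1)^t (t+1)! / (∏ (t-αₖ)! ∏ (βₖ-t)!)`, here called `T(h,i,j)` and normalized by
`h! i! j!`. As a function of `h` and `i` this sum satisfies two contiguous relations, one between
`T(h+1,i)`, `T(h,i+1)`, `T(h,i)` (`sixjSum_contiguous_up_up`) and one between `T(h-1,i)`, `T(h,i+1)`,
`T(h,i)` (`sixjSum_contiguous_down_up`); both are proved by Zeilberger telescoping. Together with their
images under `h ↔ i` they express `T` at the four neighbours of `(h,i)` through two values, and
in the interior of the triangle inequalities the difference equation becomes a rational identity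
between quadratic forms (`interior_identity`). On the edges of the region, and at the lattice points
just beyond them, denominators of that identity vanish; there the contiguous relations have only one
or two nonzero terms and are used directly.
-/

noncomputable section

namespace KreschTamvakis

/-! ### Factorials of integers and their reciprocals -/

/-- `n!` for an integer `n ≥ 0`, with the junk value `1` at negative `n`. -/
def intFact (n : ℤ) : ℝ := (n.toNat.factorial : ℝ)

/-- `1 / n!`, with the convention `1 / n! = 0` for negative integers `n`. With this convention
`n / n! = 1 / (n-1)!` for every integer `n`. -/
def invFact (n : ℤ) : ℝ := if 0 ≤ n then ((n.toNat.factorial : ℝ))⁻¹ else 0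

theorem intFact_pos (n : ℤ) : 0 < intFact n := by
  unfold intFact; exact_mod_cast Nat.factorial_pos _

theorem intFact_natCast (n : ℕ) : intFact n = (n.factorial : ℝ) := by simp [intFact]

theorem intFact_zero : intFact 0 = 1 := by simp [intFact]

theorem invFact_natCast (n : ℕ) : invFact n = ((n.factorial : ℝ))⁻¹ := by simp [invFact]

theorem invFact_zero : invFact 0 = 1 := by simp [invFact]

theorem invFact_of_neg {n : ℤ} (hn : n < 0) : invFact n = 0 := by
  simp [invFact, not_le.mpr hn]

theorem invFact_mul_intFact {n : ℤ} (hn : 0 ≤ n) : invFact n * intFact n = 1 := by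
  have := (intFact_pos n).ne'
  simp only [invFact, hn, if_true, intFact] at *
  exact inv_mul_cancel₀ this

theorem intFact_eq_mul {n : ℤ} (hn : 0 < n) : intFact n = n * intFact (n - 1) := by
  obtain ⟨m, rfl⟩ : ∃ m : ℕ, n = m + 1 := ⟨(n - 1).toNat, by omega⟩
  have h1 : ((m : ℤ) + 1).toNat = m + 1 := by omega
  simp [intFact, h1, Nat.factorial_succ]

theorem intFact_add_one {n : ℤ} (hn : 0 ≤ n) : intFact (n + 1) = (n + 1) * intFact n := by
  have := intFact_eq_mul (n := n + 1) (by omega)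
  simpa using this

theorem invFact_eq_mul {m n : ℤ} (h : n = m + 1) : invFact m = n * invFact n := by
  subst h
  rcases lt_trichotomy m (-1) with hm | rfl | hm
  · rw [invFact_of_neg (by omega), invFact_of_neg (by omega), mul_zero]
  · simp [invFact]
  · obtain ⟨k, rfl⟩ : ∃ k : ℕ, m = k := ⟨m.toNat, by omega⟩
    have h1 : invFact ((k : ℤ) + 1) = (((k + 1).factorial : ℝ))⁻¹ := by
      exact_mod_cast invFact_natCast (k + 1)
    rw [h1, invFact_natCast, Nat.factorial_succ]
    push_cast
    have : (k : ℝ) + 1 ≠ 0 := by positivity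
    field_simp

/-! ### Racah's single sum and its contiguous relations -/

/-- The summand of `racahSum`. -/
def racahTerm (α₁ α₂ α₃ α₄ β₁ β₂ β₃ : ℤ) (t : ℕ) : ℝ :=
  (-1) ^ t * ((t + 1).factorial : ℝ) *
    (invFact (t - α₁) * invFact (t - α₂) * invFact (t - α₃) * invFact (t - α₄)) *
    (invFact (β₁ - t) * invFact (β₂ - t) * invFact (β₃ - t))

/-- Racah's single sum `∑ (-1)^t (t+1)! / (∏ (t-αₖ)! ∏ (βₖ-t)!)`, over `0 ≤ t < K`. For `K > β₁` all
nonzero summands are included. -/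
def racahSum (K : ℕ) (α₁ α₂ α₃ α₄ β₁ β₂ β₃ : ℤ) : ℝ :=
  ∑ t ∈ Finset.range K, racahTerm α₁ α₂ α₃ α₄ β₁ β₂ β₃ t

theorem racahTerm_eq_zero {α₁ α₂ α₃ α₄ β₁ β₂ β₃ : ℤ} {t : ℕ}
    (h : t < α₁ ∨ t < α₂ ∨ t < α₃ ∨ t < α₄ ∨ β₁ < t ∨ β₂ < t ∨ β₃ < t) :
    racahTerm α₁ α₂ α₃ α₄ β₁ β₂ β₃ t = 0 := by
  unfold racahTerm
  rcases h with h | h | h | h | h | h | h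
  · rw [invFact_of_neg (n := t - α₁) (by omega)]; ring
  · rw [invFact_of_neg (n := t - α₂) (by omega)]; ring
  · rw [invFact_of_neg (n := t - α₃) (by omega)]; ring
  · rw [invFact_of_neg (n := t - α₄) (by omega)]; ring
  · rw [invFact_of_neg (n := β₁ - t) (by omega)]; ring
  · rw [invFact_of_neg (n := β₂ - t) (by omega)]; ring
  · rw [invFact_of_neg (n := β₃ - t) (by omega)]; ring

/-- The Racah sum of the `6j`-symbol `{h i j; N/2 N/2 N/2}`. -/
def sixjSum (N : ℕ) (h i j : ℤ) : ℝ :=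
  racahSum (4 * N + 4) (h + i + j) (N + h) (N + i) (N + j) (N + h + i) (N + h + j) (N + i + j)

theorem sixjSum_swap_left (N : ℕ) (h i j : ℤ) : sixjSum N i h j = sixjSum N h i j := by
  unfold sixjSum racahSum racahTerm
  refine Finset.sum_congr rfl fun t _ => ?_
  rw [show i + h + j = h + i + j by ring, show (N : ℤ) + i + h = N + h + i by ring]
  ring

/-- Outside the triangle inequalities, and beyond the range `h, i, j ≤ N`, every summand
vanishes. -/
theorem sixjSum_eq_zero {N : ℕ} {h i j : ℤ}
    (H : i + j < h ∨ h + j < i ∨ h + i < j ∨ N < h ∨ N < i ∨ N < j) : sixjSum N h i j = 0 := by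
  unfold sixjSum racahSum
  refine Finset.sum_eq_zero fun t _ => racahTerm_eq_zero ?_
  omega

/-- Contiguous relation between `(h+1,i)`, `(h,i+1)` and `(h,i)`. -/
theorem sixjSum_contiguous_up_up {N : ℕ} {h i j : ℤ} (hj : 0 ≤ j)
    (hiN : i ≤ N) (hjN : j ≤ N) :
    ((h : ℝ) + 1 - i + j) * (h + 1) * sixjSum N (h + 1) i j
      - ((i : ℝ) + 1 - h + j) * (i + 1) * sixjSum N h (i + 1) j
      = ((h : ℝ) - i) * (h + i + j + 2) * sixjSum N h i j := by
  -- Zeilberger's certificate: the difference of the two sides is `∑ (V (t+1) - V t)`.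
  set V : ℕ → ℝ := fun t => (-1) ^ t * ((t + 1).factorial : ℝ) * ((h : ℝ) - i) *
    (invFact (t - 1 - (h + i + j)) * invFact (t - 1 - (N + h)) * invFact (t - 1 - (N + i)) *
      invFact (t - 1 - (N + j))) *
    (invFact (N + h + i + 1 - t) * invFact (N + h + j + 1 - t) * invFact (N + i + j + 1 - t))
    with hV
  have h0 : V 0 = 0 := by
    have : invFact (((0 : ℕ) : ℤ) - 1 - (N + j)) = 0 := invFact_of_neg (by push_cast; omega)
    simp only [hV, this]; ring
  have hK : V (4 * N + 4) = 0 := by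
    have : invFact ((N : ℤ) + i + j + 1 - ((4 * N + 4 : ℕ) : ℤ)) = 0 :=
      invFact_of_neg (by push_cast; omega)
    simp only [hV, this]; ring
  have key := Finset.sum_range_sub V (4 * N + 4)
  rw [h0, hK, sub_zero] at key
  rw [← sub_eq_zero, ← key]
  unfold sixjSum racahSum
  rw [Finset.mul_sum, Finset.mul_sum, Finset.mul_sum, ← Finset.sum_sub_distrib,
    ← Finset.sum_sub_distrib]
  refine Finset.sum_congr rfl fun t _ => ?_
  simp only [hV, racahTerm]
  have e1 : ((t + 1 : ℕ) : ℤ) - 1 = t := by push_cast; ring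
  rw [e1]
  have hA := invFact_eq_mul (m := t - 1 - (h + i + j)) (n := t - (h + i + j)) (by ring)
  have hE := invFact_eq_mul (m := t - 1 - (N + h)) (n := t - (N + h)) (by ring)
  have hB := invFact_eq_mul (m := t - 1 - (N + i)) (n := t - (N + i)) (by ring)
  have hC := invFact_eq_mul (m := t - 1 - (N + j)) (n := t - (N + j)) (by ring)
  have hF := invFact_eq_mul (m := N + h + i - t) (n := N + h + i + 1 - t) (by ring)
  have hG := invFact_eq_mul (m := N + h + j - t) (n := N + h + j + 1 - t) (by ring)
  have hH := invFact_eq_mul (m := N + i + j - t) (n := N + i + j + 1 - t) (by ring)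
  rw [show (t : ℤ) - (h + 1 + i + j) = t - 1 - (h + i + j) by ring,
    show (t : ℤ) - (N + (h + 1)) = t - 1 - (N + h) by ring,
    show (N : ℤ) + (h + 1) + i - t = N + h + i + 1 - t by ring,
    show (N : ℤ) + (h + 1) + j - t = N + h + j + 1 - t by ring,
    show (t : ℤ) - (h + (i + 1) + j) = t - 1 - (h + i + j) by ring,
    show (t : ℤ) - (N + (i + 1)) = t - 1 - (N + i) by ring,
    show (N : ℤ) + h + (i + 1) - t = N + h + i + 1 - t by ring,
    show (N : ℤ) + (i + 1) + j - t = N + i + j + 1 - t by ring,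
    show (N : ℤ) + h + i + 1 - ((t + 1 : ℕ) : ℤ) = N + h + i - t by push_cast; ring,
    show (N : ℤ) + h + j + 1 - ((t + 1 : ℕ) : ℤ) = N + h + j - t by push_cast; ring,
    show (N : ℤ) + i + j + 1 - ((t + 1 : ℕ) : ℤ) = N + i + j - t by push_cast; ring,
    hA, hB, hC, hE, hF, hG, hH, Nat.factorial_succ (t + 1), pow_succ (-1 : ℝ) t]
  push_cast
  ring

/-- Contiguous relation between `(h-1,i)`, `(h,i+1)` and `(h,i)`. -/
theorem sixjSum_contiguous_down_up {N : ℕ} {h i j : ℤ} (hj : 0 ≤ j)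
    (hiN : i ≤ N) (hjN : j ≤ N) :
    (((N : ℝ) + 1) ^ 2 - h ^ 2) * (i + j + h + 1) * sixjSum N (h - 1) i j
      + (h : ℝ) * (i + 1) * (i + 1 + h - j) * sixjSum N h (i + 1) j
      = -((h : ℝ) * (h + i + 1) * (j + h - i)) * sixjSum N h i j := by
  -- Zeilberger's certificate, as above.
  set V : ℕ → ℝ := fun t => (-1) ^ t * ((t + 1).factorial : ℝ) *
    (h * ((N - h - i) * ((t : ℝ) - (i + h + N + 1)) - (i + 1) * (N + 1 - j))
      - (N + 1) * (t - (i + h + N + 1)) * (t - (i + j + N + 1))) *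
    (invFact (t - (h + i + j)) * invFact (t - (N + h)) * invFact (t - 1 - (N + i)) *
      invFact (t - 1 - (N + j))) *
    (invFact (N + h + i + 1 - t) * invFact (N + h + j - t) * invFact (N + i + j + 1 - t))
    with hV
  have h0 : V 0 = 0 := by
    have : invFact (((0 : ℕ) : ℤ) - 1 - (N + j)) = 0 := invFact_of_neg (by push_cast; omega)
    simp only [hV, this]; ring
  have hK : V (4 * N + 4) = 0 := by
    have : invFact ((N : ℤ) + i + j + 1 - ((4 * N + 4 : ℕ) : ℤ)) = 0 :=
      invFact_of_neg (by push_cast; omega)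
    simp only [hV, this]; ring
  have key := Finset.sum_range_sub V (4 * N + 4)
  rw [h0, hK, sub_zero] at key
  rw [neg_mul, ← sub_eq_zero, sub_neg_eq_add, ← key]
  unfold sixjSum racahSum
  rw [Finset.mul_sum, Finset.mul_sum, Finset.mul_sum, ← Finset.sum_add_distrib,
    ← Finset.sum_add_distrib]
  refine Finset.sum_congr rfl fun t _ => ?_
  simp only [hV, racahTerm]
  have e1 : ((t + 1 : ℕ) : ℤ) - 1 = t := by push_cast; ring
  rw [e1]
  have hA' := invFact_eq_mul (m := t - 1 - (h + i + j)) (n := t - (h + i + j)) (by ring)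
  have hA := invFact_eq_mul (m := t - (h + i + j)) (n := t + 1 - (h + i + j)) (by ring)
  have hE := invFact_eq_mul (m := t - (N + h)) (n := t + 1 - (N + h)) (by ring)
  have hB := invFact_eq_mul (m := t - 1 - (N + i)) (n := t - (N + i)) (by ring)
  have hC := invFact_eq_mul (m := t - 1 - (N + j)) (n := t - (N + j)) (by ring)
  have hF' := invFact_eq_mul (m := N + h + i - 1 - t) (n := N + h + i - t) (by ring)
  have hF := invFact_eq_mul (m := N + h + i - t) (n := N + h + i + 1 - t) (by ring)
  have hG := invFact_eq_mul (m := N + h + j - 1 - t) (n := N + h + j - t) (by ring)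
  have hH := invFact_eq_mul (m := N + i + j - t) (n := N + i + j + 1 - t) (by ring)
  rw [show (t : ℤ) - (h - 1 + i + j) = t + 1 - (h + i + j) by ring,
    show (t : ℤ) - (N + (h - 1)) = t + 1 - (N + h) by ring,
    show (N : ℤ) + (h - 1) + i - t = N + h + i - 1 - t by ring,
    show (N : ℤ) + (h - 1) + j - t = N + h + j - 1 - t by ring,
    show (t : ℤ) - (h + (i + 1) + j) = t - 1 - (h + i + j) by ring,
    show (t : ℤ) - (N + (i + 1)) = t - 1 - (N + i) by ring,
    show (N : ℤ) + h + (i + 1) - t = N + h + i + 1 - t by ring,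
    show (N : ℤ) + (i + 1) + j - t = N + i + j + 1 - t by ring,
    show ((t + 1 : ℕ) : ℤ) - (h + i + j) = t + 1 - (h + i + j) by push_cast; ring,
    show ((t + 1 : ℕ) : ℤ) - (N + h) = t + 1 - (N + h) by push_cast; ring,
    show (N : ℤ) + h + i + 1 - ((t + 1 : ℕ) : ℤ) = N + h + i - t by push_cast; ring,
    show (N : ℤ) + h + j - ((t + 1 : ℕ) : ℤ) = N + h + j - 1 - t by push_cast; ring,
    show (N : ℤ) + i + j + 1 - ((t + 1 : ℕ) : ℤ) = N + i + j - t by push_cast; ring,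
    hA', hA, hB, hC, hE, hF', hF, hG, hH, Nat.factorial_succ (t + 1), pow_succ (-1 : ℝ) t]
  push_cast
  generalize invFact (t + 1 - (h + i + j)) = fA
  generalize invFact (t + 1 - (N + h)) = fE
  generalize invFact (t - (N + i)) = fB
  generalize invFact (t - (N + j)) = fC
  generalize invFact (N + h + i + 1 - t) = fF
  generalize invFact (N + h + j - t) = fG
  generalize invFact (N + i + j + 1 - t) = fH
  ring

/-! ### The squared `6j`-symbol -/

/-- `h! i! j!` times the Racah sum; this scaling makes the contiguous relations polynomial. -/
def scaledSum (N : ℕ) (h i j : ℤ) : ℝ :=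
  intFact h * intFact i * intFact j * sixjSum N h i j

/-- `(N-h)! / (N+h+1)!`, which is `Δ(N/2, N/2, h)² / h!²`. -/
def sideWeight (N : ℕ) (h : ℤ) : ℝ := intFact (N - h) * invFact (N + h + 1)

/-- `Δ(h,i,j)²` times the three `sideWeight`s; only meaningful inside the triangle inequalities. -/
def sixjWeight (N : ℕ) (h i j : ℤ) : ℝ :=
  intFact (i + j - h) * intFact (h + j - i) * intFact (h + i - j) * invFact (h + i + j + 1) *
    (sideWeight N h * sideWeight N i * sideWeight N j)

/-- The square of the `6j`-symbol `{h i j; N/2 N/2 N/2}`, extended by `0` outside the range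
`0 ≤ h, i, j ≤ N` cut out by the triangle inequalities. -/
def sixjSq (N : ℕ) (h i j : ℤ) : ℝ := sixjWeight N h i j * scaledSum N h i j ^ 2

theorem scaledSum_swap_left (N : ℕ) (h i j : ℤ) : scaledSum N i h j = scaledSum N h i j := by
  unfold scaledSum; rw [sixjSum_swap_left]; ring

theorem sixjWeight_swap_left (N : ℕ) (h i j : ℤ) : sixjWeight N i h j = sixjWeight N h i j := by
  unfold sixjWeight
  rw [show i + h - j = h + i - j by ring, show i + h + j + 1 = h + i + j + 1 by ring]
  ring

theorem sixjSq_swap_left (N : ℕ) (h i j : ℤ) : sixjSq N i h j = sixjSq N h i j := by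
  unfold sixjSq; rw [scaledSum_swap_left, sixjWeight_swap_left]

theorem scaledSum_eq_zero {N : ℕ} {h i j : ℤ}
    (H : i + j < h ∨ h + j < i ∨ h + i < j ∨ N < h ∨ N < i ∨ N < j) : scaledSum N h i j = 0 := by
  unfold scaledSum; rw [sixjSum_eq_zero H, mul_zero]

theorem sixjSq_eq_zero {N : ℕ} {h i j : ℤ}
    (H : i + j < h ∨ h + j < i ∨ h + i < j ∨ N < h ∨ N < i ∨ N < j) : sixjSq N h i j = 0 := by
  unfold sixjSq; rw [scaledSum_eq_zero H]; ring

theorem scaledSum_up_up {N : ℕ} {h i j : ℤ} (hh : 0 ≤ h) (hi : 0 ≤ i) (hj : 0 ≤ j)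
    (hiN : i ≤ N) (hjN : j ≤ N) :
    ((h : ℝ) + 1 - i + j) * scaledSum N (h + 1) i j
      - ((i : ℝ) + 1 - h + j) * scaledSum N h (i + 1) j
      = ((h : ℝ) - i) * (h + i + j + 2) * scaledSum N h i j := by
  have := sixjSum_contiguous_up_up (h := h) hj hiN hjN
  unfold scaledSum
  rw [intFact_add_one hh, intFact_add_one hi]
  linear_combination (intFact h * intFact i * intFact j) * this

theorem scaledSum_down_up {N : ℕ} {h i j : ℤ} (hh : 0 < h) (hi : 0 ≤ i) (hj : 0 ≤ j)
    (hiN : i ≤ N) (hjN : j ≤ N) :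
    ((i : ℝ) + j + h + 1) * ((((N : ℝ) + 1) ^ 2 - h ^ 2) * scaledSum N (h - 1) i j)
      + ((i : ℝ) + 1 + h - j) * scaledSum N h (i + 1) j
      = -(((h : ℝ) + i + 1) * (j + h - i)) * scaledSum N h i j := by
  have := sixjSum_contiguous_down_up (h := h) hj hiN hjN
  unfold scaledSum
  rw [intFact_add_one hi, intFact_eq_mul hh]
  linear_combination (intFact (h - 1) * intFact i * intFact j) * this

theorem sideWeight_eq {N : ℕ} {h : ℤ} (hN : h < N) :
    sideWeight N h = (((N : ℝ) + 1) ^ 2 - (h + 1) ^ 2) * sideWeight N (h + 1) := by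
  unfold sideWeight
  rw [invFact_eq_mul (m := N + h + 1) (n := N + (h + 1) + 1) (by ring),
    intFact_eq_mul (n := N - h) (by omega), show (N : ℤ) - h - 1 = N - (h + 1) by ring]
  push_cast; ring

/-- The ratio of consecutive weights. -/
theorem sixjWeight_up {N : ℕ} {h i j : ℤ} (hN : h < N) (h1 : h < i + j)
    (h2 : i ≤ h + j) (h3 : j ≤ h + i) :
    sixjWeight N (h + 1) i j * ((((N : ℝ) + 1) ^ 2 - (h + 1) ^ 2) * ((i + j - h) * (i + j + h + 2)))
      = sixjWeight N h i j * ((h + 1 + i - j) * (h + 1 - i + j)) := by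
  unfold sixjWeight
  rw [sideWeight_eq hN, invFact_eq_mul (m := h + i + j + 1) (n := h + 1 + i + j + 1) (by ring),
    intFact_eq_mul (n := i + j - h) (by omega),
    show h + 1 + j - i = h + j - i + 1 by ring, intFact_add_one (n := h + j - i) (by omega),
    show h + 1 + i - j = h + i - j + 1 by ring, intFact_add_one (n := h + i - j) (by omega),
    show i + j - h - 1 = i + j - (h + 1) by ring]
  push_cast; ring

/-- The weights on the two sides of a lattice point just beyond the edge `h = i + j`. -/
theorem sixjWeight_edge {N : ℕ} {i j : ℤ} (hi : 0 ≤ i) (hj : 0 ≤ j) (hN : i + j < N) :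
    sixjWeight N (i + j) i j * ((2 * i + 1) * (2 * i + 2)) =
      sixjWeight N (i + j + 1) (i + 1) j * ((2 * (i + j) + 3) * (2 * (i + j) + 2) *
        ((((N : ℝ) + 1) ^ 2 - (i + j + 1) ^ 2) * (((N : ℝ) + 1) ^ 2 - (i + 1) ^ 2))) := by
  unfold sixjWeight
  rw [sideWeight_eq hN, sideWeight_eq (h := i) (by omega),
    invFact_eq_mul (m := i + j + i + j + 1) (n := i + j + i + j + 2) (by ring),
    invFact_eq_mul (m := i + j + i + j + 2) (n := i + j + 1 + (i + 1) + j + 1) (by ring),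
    show i + 1 + j - (i + j + 1) = i + j - (i + j) by ring,
    show i + j + 1 + j - (i + 1) = i + j + j - i by ring,
    show i + j + 1 + (i + 1) - j = i + j + i - j + 1 + 1 by ring,
    intFact_add_one (n := i + j + i - j + 1) (by omega),
    intFact_add_one (n := i + j + i - j) (by omega)]
  push_cast; ring

/-- The weights on the two sides of a lattice point just beyond the edge `j = h + i`. -/
theorem sixjWeight_edge' {N : ℕ} {h i : ℤ} (hh : 0 ≤ h) (hi : 0 ≤ i) (hN : h + i < N) :
    sixjWeight N (h + 1) i (h + i + 1) *
        ((2 * i + 1) * (2 * i + 2) * (((N : ℝ) + 1) ^ 2 - (h + 1) ^ 2)) =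
      sixjWeight N h (i + 1) (h + i + 1) *
        ((2 * h + 1) * (2 * h + 2) * (((N : ℝ) + 1) ^ 2 - (i + 1) ^ 2)) := by
  unfold sixjWeight
  rw [sideWeight_eq (h := h) (by omega), sideWeight_eq (h := i) (by omega),
    show i + (h + i + 1) - (h + 1) = 2 * i by ring,
    show h + 1 + (h + i + 1) - i = 2 * h + 1 + 1 by ring,
    show h + 1 + i - (h + i + 1) = 0 by ring,
    show i + 1 + (h + i + 1) - h = 2 * i + 1 + 1 by ring,
    show h + (h + i + 1) - (i + 1) = 2 * h by ring,
    show h + (i + 1) - (h + i + 1) = 0 by ring,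
    show h + (i + 1) + (h + i + 1) + 1 = h + 1 + i + (h + i + 1) + 1 by ring,
    intFact_add_one (n := 2 * i + 1) (by omega), intFact_add_one (n := 2 * i) (by omega),
    intFact_add_one (n := 2 * h + 1) (by omega), intFact_add_one (n := 2 * h) (by omega)]
  push_cast; ring

/-! ### The difference equation for the squared `6j`-symbol -/

/-- The coefficient `D (D+2) b_h / 3`, for `D = N`. -/
def upCoeff (N : ℕ) (h : ℤ) : ℝ := (((N : ℝ) + 1) ^ 2 - (h + 1) ^ 2) * (h + 1) / (2 * h + 1)

/-- The coefficient `D (D+2) c_h / 3`, for `D = N`. -/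
def downCoeff (N : ℕ) (h : ℤ) : ℝ := (((N : ℝ) + 1) ^ 2 - h ^ 2) * h / (2 * h + 1)

/-- At `h = N` both sides vanish; this case lies outside the range of `sixjWeight_up`. -/
theorem upCoeff_mul_sixjSq {N : ℕ} {h i j : ℤ} (hN : h ≤ N) (h1 : h < i + j)
    (h2 : i ≤ h + j) (h3 : j ≤ h + i) :
    upCoeff N h * sixjSq N (h + 1) i j = sixjWeight N h i j * ((h + 1) / (2 * h + 1) *
      ((h + 1 + i - j) * (h + 1 - i + j) / ((i + j - h) * (i + j + h + 2)) *
        scaledSum N (h + 1) i j ^ 2)) := by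
  rcases hN.lt_or_eq with hN | hN
  · have k := sixjWeight_up hN h1 h2 h3
    have p1 : (0 : ℝ) < i + j - h := by exact_mod_cast (by omega : 0 < i + j - h)
    have p2 : (0 : ℝ) < i + j + h + 2 := by exact_mod_cast (by omega : 0 < i + j + h + 2)
    have k' : sixjWeight N (h + 1) i j * (((N : ℝ) + 1) ^ 2 - (h + 1) ^ 2) = sixjWeight N h i j *
        ((h + 1 + i - j) * (h + 1 - i + j) / ((i + j - h) * (i + j + h + 2))) := by
      rw [mul_div_assoc', eq_div_iff (mul_pos p1 p2).ne']
      linear_combination k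
    unfold upCoeff sixjSq
    linear_combination ((h + 1) / (2 * h + 1) * scaledSum N (h + 1) i j ^ 2) * k'
  · have z : scaledSum N (h + 1) i j = 0 := scaledSum_eq_zero (by omega)
    unfold sixjSq; rw [z]; ring

theorem downCoeff_mul_sixjSq {N : ℕ} {h i j : ℤ} (hN : h ≤ N) (h1 : h ≤ i + j)
    (h2 : i < h + j) (h3 : j < h + i) :
    downCoeff N h * sixjSq N (h - 1) i j = sixjWeight N h i j * (h / (2 * h + 1) *
      ((i + j + 1 - h) * (i + j + h + 1) / ((h + i - j) * (h - i + j)) *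
        ((((N : ℝ) + 1) ^ 2 - h ^ 2) * scaledSum N (h - 1) i j) ^ 2)) := by
  have k := sixjWeight_up (N := N) (h := h - 1) (i := i) (j := j) (by omega) (by omega) (by omega)
    (by omega)
  rw [sub_add_cancel] at k
  push_cast at k
  have p1 : (0 : ℝ) < h + i - j := by exact_mod_cast (by omega : 0 < h + i - j)
  have p2 : (0 : ℝ) < h - i + j := by exact_mod_cast (by omega : 0 < h - i + j)
  have k' : sixjWeight N (h - 1) i j = sixjWeight N h i j * (((N : ℝ) + 1) ^ 2 - h ^ 2) *
      ((i + j + 1 - h) * (i + j + h + 1) / ((h + i - j) * (h - i + j))) := by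
    rw [mul_div_assoc', eq_div_iff (mul_pos p1 p2).ne']
    linear_combination -k
  unfold downCoeff sixjSq
  linear_combination
    ((((N : ℝ) + 1) ^ 2 - h ^ 2) * h / (2 * h + 1) * scaledSum N (h - 1) i j ^ 2) * k'

/-- The operator `D (D+2)/3 · A` (with `D = N`) acting on a function of the row index. -/
def racahOp (N : ℕ) (φ : ℤ → ℝ) (h : ℤ) : ℝ :=
  upCoeff N h * φ (h + 1) + h * (h + 1) * φ h + downCoeff N h * φ (h - 1)

/-- The difference equation on the edge `h = i + j`. -/
theorem racahOp_edge {N : ℕ} {i j : ℤ} (hi : 0 ≤ i) (hj : 0 ≤ j) (hN : i + j ≤ N) :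
    racahOp N (fun x => sixjSq N x i j) (i + j) = racahOp N (fun x => sixjSq N (i + j) x j) i := by
  unfold racahOp
  simp only
  rw [sixjSq_eq_zero (h := i + j + 1) (by omega)]
  rcases hj.eq_or_lt with rfl | hj'
  · rw [sixjSq_eq_zero (h := i + 0 - 1) (by omega), sixjSq_eq_zero (i := i + 1) (by omega),
      sixjSq_eq_zero (i := i - 1) (by omega)]
    push_cast; ring
  rw [sixjSq_eq_zero (i := i - 1) (by omega)]
  have pj : (0 : ℝ) < j := by exact_mod_cast hj'
  have pi : (0 : ℝ) ≤ i := by exact_mod_cast hi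
  have u1 := upCoeff_mul_sixjSq (N := N) (h := i) (i := i + j) (j := j) (by omega) (by omega)
    (by omega) (by omega)
  rw [sixjSq_swap_left] at u1
  have m1 := scaledSum_up_up (N := N) (h := i + j) (i := i) (j := j) (by omega) hi hj (by omega)
    (by omega)
  rw [scaledSum_eq_zero (h := i + j + 1) (by omega)] at m1
  rw [scaledSum_swap_left, sixjWeight_swap_left] at u1
  rw [u1]
  push_cast at m1 ⊢
  have x' : scaledSum N (i + j) (i + 1) j = -(j * (2 * i + 2 * j + 2)) *
      scaledSum N (i + j) i j := by linear_combination -m1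
  rw [x']
  rcases hi.eq_or_lt with rfl | hi'
  · rw [sixjSq_eq_zero (h := 0 + j - 1) (by omega)]
    unfold sixjSq
    push_cast
    simp only [zero_add, mul_zero, sub_zero, add_zero, zero_mul]
    field_simp
    ring
  · have d1 := downCoeff_mul_sixjSq (N := N) (h := i + j) (i := i) (j := j) (by omega) (by omega)
      (by omega) (by omega)
    have m2 := scaledSum_down_up (N := N) (h := i + j) (i := i) (j := j) (by omega) hi hj (by omega)
      (by omega)
    have pi' : (0 : ℝ) < i := by exact_mod_cast hi'
    rw [d1]
    push_cast at m2 ⊢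
    rw [x'] at m2
    have y : (((N : ℝ) + 1) ^ 2 - (i + j) ^ 2) * scaledSum N (i + j - 1) i j =
        2 * i * j * scaledSum N (i + j) i j := by
      have : (0 : ℝ) < 2 * i + 2 * j + 1 := by positivity
      apply mul_left_cancel₀ this.ne'
      linear_combination m2
    rw [y]
    unfold sixjSq
    rw [show (i : ℝ) + j + j - i = 2 * j by ring, show (i : ℝ) + j - i + j = 2 * j by ring,
      show (i : ℝ) + j + i - j = 2 * i by ring, show (i : ℝ) + j + j + i + 2 = 2 * (i + j + 1) by ring,
      show (i : ℝ) + 1 + (i + j) - j = 2 * i + 1 by ring,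
      show (i : ℝ) + 1 - (i + j) + j = 1 by ring]
    field_simp
    ring

/-- The difference equation on the edge `j = h + i`. -/
theorem racahOp_edge' {N : ℕ} {h i : ℤ} (hh : 0 < h) (hi : 0 < i) (hN : h + i ≤ N) :
    racahOp N (fun x => sixjSq N x i (h + i)) h = racahOp N (fun x => sixjSq N h x (h + i)) i := by
  unfold racahOp
  simp only
  rw [sixjSq_eq_zero (h := h - 1) (by omega), sixjSq_eq_zero (i := i - 1) (by omega)]
  have ph : (0 : ℝ) < h := by exact_mod_cast hh
  have pi : (0 : ℝ) < i := by exact_mod_cast hi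
  have u1 := upCoeff_mul_sixjSq (N := N) (h := h) (i := i) (j := h + i) (by omega) (by omega)
    (by omega) (by omega)
  have u2 := upCoeff_mul_sixjSq (N := N) (h := i) (i := h) (j := h + i) (by omega) (by omega)
    (by omega) (by omega)
  have m1 := scaledSum_down_up (N := N) (h := h) (i := i) (j := h + i) hh hi.le (by omega)
    (by omega) (by omega)
  have m2 := scaledSum_down_up (N := N) (h := i) (i := h) (j := h + i) hi hh.le (by omega)
    (by omega) (by omega)
  rw [sixjSq_swap_left, sixjWeight_swap_left, scaledSum_swap_left] at u2
  rw [scaledSum_eq_zero (h := h - 1) (by omega)] at m1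
  rw [scaledSum_swap_left (h := h) (i := i - 1), scaledSum_eq_zero (i := i - 1) (by omega),
    scaledSum_swap_left, scaledSum_swap_left (h := h)] at m2
  rw [u1, u2]
  push_cast at m1 m2 ⊢
  have x' : scaledSum N h (i + 1) (h + i) = -((h + i + 1) * (2 * h)) * scaledSum N h i (h + i) := by
    linear_combination m1
  have x : scaledSum N (h + 1) i (h + i) = -((h + i + 1) * (2 * i)) * scaledSum N h i (h + i) := by
    linear_combination m2
  rw [x, x']
  unfold sixjSq
  rw [show (h : ℝ) + 1 + i - (h + i) = 1 by ring, show (i : ℝ) + 1 + h - (h + i) = 1 by ring,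
    show (h : ℝ) + 1 - i + (h + i) = 2 * h + 1 by ring,
    show (i : ℝ) + 1 - h + (h + i) = 2 * i + 1 by ring,
    show (i : ℝ) + (h + i) - h = 2 * i by ring, show (h : ℝ) + (h + i) - i = 2 * h by ring,
    show (i : ℝ) + (h + i) + h + 2 = 2 * (h + i + 1) by ring,
    show (h : ℝ) + (h + i) + i + 2 = 2 * (h + i + 1) by ring]
  field_simp
  ring

/-- The difference equation just beyond the edge `h = i + j`. -/
theorem racahOp_beyond {N : ℕ} {i j : ℤ} (hi : 0 ≤ i) (hj : 0 ≤ j) (hN : i + j < N) :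
    racahOp N (fun x => sixjSq N x i j) (i + j + 1) =
      racahOp N (fun x => sixjSq N (i + j + 1) x j) i := by
  unfold racahOp
  simp only
  rw [sixjSq_eq_zero (h := i + j + 1 + 1) (by omega), sixjSq_eq_zero (h := i + j + 1) (i := i)
    (by omega), sixjSq_eq_zero (i := i - 1) (by omega), add_sub_cancel_right]
  have w := sixjWeight_edge hi hj hN
  have m := scaledSum_down_up (N := N) (h := i + j + 1) (i := i) (j := j) (by omega) hi hj (by omega)
    (by omega)
  rw [scaledSum_eq_zero (h := i + j + 1) (i := i) (by omega), add_sub_cancel_right] at m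
  have pj : (0 : ℝ) ≤ j := by exact_mod_cast hj
  have pi : (0 : ℝ) ≤ i := by exact_mod_cast hi
  unfold sixjSq upCoeff downCoeff
  push_cast at m ⊢
  have x' : scaledSum N (i + j + 1) (i + 1) j = -((i + j + 1) / (i + 1) *
      ((((N : ℝ) + 1) ^ 2 - (i + j + 1) ^ 2) * scaledSum N (i + j) i j)) := by
    field_simp
    linear_combination m / 2
  have w' : sixjWeight N (i + j) i j =
      sixjWeight N (i + j + 1) (i + 1) j * ((2 * (i + j) + 3) * (2 * (i + j) + 2) *
        ((((N : ℝ) + 1) ^ 2 - (i + j + 1) ^ 2) * (((N : ℝ) + 1) ^ 2 - (i + 1) ^ 2))) /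
        ((2 * i + 1) * (2 * i + 2)) := by
    rw [← w]; field_simp
  rw [x', w']
  generalize ((N : ℝ) + 1) ^ 2 = M
  have : 2 * ((i : ℝ) + j + 1) + 1 = 2 * (i + j) + 3 := by ring
  rw [this]
  field_simp
  ring

/-- The difference equation just beyond the edge `j = h + i`. -/
theorem racahOp_beyond' {N : ℕ} {h i : ℤ} (hh : 0 ≤ h) (hi : 0 ≤ i) (hN : h + i < N) :
    racahOp N (fun x => sixjSq N x i (h + i + 1)) h =
      racahOp N (fun x => sixjSq N h x (h + i + 1)) i := by
  unfold racahOp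
  simp only
  rw [sixjSq_eq_zero (h := h - 1) (by omega), sixjSq_eq_zero (h := h) (i := i) (by omega),
    sixjSq_eq_zero (i := i - 1) (by omega)]
  have w := sixjWeight_edge' hh hi hN
  have m := scaledSum_up_up (N := N) (h := h) (i := i) (j := h + i + 1) hh hi (by omega) (by omega)
    (by omega)
  rw [scaledSum_eq_zero (h := h) (i := i) (by omega)] at m
  have ph : (0 : ℝ) ≤ h := by exact_mod_cast hh
  have pi : (0 : ℝ) ≤ i := by exact_mod_cast hi
  unfold sixjSq upCoeff
  push_cast at m ⊢
  have x' : scaledSum N h (i + 1) (h + i + 1) =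
      (h + 1) / (i + 1) * scaledSum N (h + 1) i (h + i + 1) := by
    field_simp
    linear_combination -m / 2
  have w' : sixjWeight N (h + 1) i (h + i + 1) * (((N : ℝ) + 1) ^ 2 - (h + 1) ^ 2) =
      sixjWeight N h (i + 1) (h + i + 1) *
        ((2 * h + 1) * (2 * h + 2) * (((N : ℝ) + 1) ^ 2 - (i + 1) ^ 2)) /
        ((2 * i + 1) * (2 * i + 2)) := by
    rw [eq_div_iff (by positivity), ← w]; ring
  rw [x']
  have : (((N : ℝ) + 1) ^ 2 - (h + 1) ^ 2) * (h + 1) / (2 * h + 1) *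
      (sixjWeight N (h + 1) i (h + i + 1) * scaledSum N (h + 1) i (h + i + 1) ^ 2) =
      (sixjWeight N (h + 1) i (h + i + 1) * (((N : ℝ) + 1) ^ 2 - (h + 1) ^ 2)) *
        ((h + 1) / (2 * h + 1) * scaledSum N (h + 1) i (h + i + 1) ^ 2) := by ring
  rw [this, w']
  generalize ((N : ℝ) + 1) ^ 2 = M
  field_simp
  ring

/-- The rational identity behind the difference equation in the interior, with
`h = (b+c)/2`, `i = (a+c)/2`, `j = (a+b)/2`. The variables `x, x', w` stand for the scaled Racah sum
at `h + 1`, at `i + 1` and at the central point; `y, y'` stand for its values at `h - 1` and `i - 1`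
times `(N+1)² - h²` and `(N+1)² - i²`. The hypotheses are the contiguous relations. -/
theorem interior_identity {a b c x y x' y' w : ℝ} (ha : 0 < a) (hb : 0 < b) (hc : 0 < c)
    (m : (b + 1) * x - (a + 1) * x' = (b - a) / 2 * (a + b + c + 2) * w)
    (m1 : (a + b + c + 1) * y + (c + 1) * x' = -((a + b + 2 * c + 2) / 2 * b) * w)
    (m2 : (a + b + c + 1) * y' + (c + 1) * x = -((a + b + 2 * c + 2) / 2 * a) * w) :
    ((b + c) / 2 + 1) / (b + c + 1) * ((c + 1) * (b + 1) / (a * (a + b + c + 2)) * x ^ 2)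
      + (b + c) / 2 * ((b + c) / 2 + 1) * w ^ 2
      + (b + c) / 2 / (b + c + 1) * ((a + 1) * (a + b + c + 1) / (c * b) * y ^ 2) =
    ((a + c) / 2 + 1) / (a + c + 1) * ((c + 1) * (a + 1) / (b * (a + b + c + 2)) * x' ^ 2)
      + (a + c) / 2 * ((a + c) / 2 + 1) * w ^ 2
      + (a + c) / 2 / (a + c + 1) * ((b + 1) * (a + b + c + 1) / (c * a) * y' ^ 2) := by
  have pa : (0 : ℝ) < a + 1 := by linarith
  have ps : (0 : ℝ) < a + b + c + 1 := by linarith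
  -- The substitution `x = (a+1) z`, `w = (a+1) v` solves the first relation for `x'`
  -- without denominators.
  obtain ⟨z, rfl⟩ : ∃ z, x = (a + 1) * z := ⟨x / (a + 1), by field_simp⟩
  obtain ⟨v, rfl⟩ : ∃ v, w = (a + 1) * v := ⟨w / (a + 1), by field_simp⟩
  obtain rfl : x' = (b + 1) * z - (b - a) / 2 * (a + b + c + 2) * v := by
    apply mul_left_cancel₀ pa.ne'
    linear_combination -m
  obtain rfl : y = -((a + b + 2 * c + 2) / 2 * b * ((a + 1) * v) + (c + 1) *
      ((b + 1) * z - (b - a) / 2 * (a + b + c + 2) * v)) / (a + b + c + 1) := by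
    rw [eq_div_iff ps.ne']
    linear_combination m1
  obtain rfl : y' = -((a + b + 2 * c + 2) / 2 * a * ((a + 1) * v) + (c + 1) *
      ((a + 1) * z)) / (a + b + c + 1) := by
    rw [eq_div_iff ps.ne']
    linear_combination m2
  field_simp
  ring

/-- The square of the `6j`-symbol satisfies the same difference equation in two of its
arguments. -/
theorem racahOp_sixjSq {N : ℕ} {h i j : ℤ} (hh : 0 ≤ h) (hi : 0 ≤ i) (hj : 0 ≤ j)
    (hhN : h ≤ N) (hiN : i ≤ N) (hjN : j ≤ N) :
    racahOp N (fun x => sixjSq N x i j) h = racahOp N (fun x => sixjSq N h x j) i := by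
  have swap : ∀ h i : ℤ, racahOp N (fun x => sixjSq N i x j) h =
      racahOp N (fun x => sixjSq N x i j) h := fun h i => by
    simp only [racahOp, sixjSq_swap_left]
  by_cases e1 : h = i + j
  · subst e1; exact racahOp_edge hi hj hhN
  by_cases e2 : i = h + j
  · subst e2; rw [← swap, ← racahOp_edge hh hj hiN, swap]
  by_cases e3 : h = i + j + 1
  · subst e3; exact racahOp_beyond hi hj (by omega)
  by_cases e4 : i = h + j + 1
  · subst e4; rw [← swap, ← racahOp_beyond hh hj (by omega), swap]
  by_cases e5 : j = h + i
  · subst e5; exact racahOp_edge' (by omega) (by omega) hjN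
  by_cases e6 : j = h + i + 1
  · subst e6; exact racahOp_beyond' hh hi (by omega)
  -- Two or more steps beyond an edge every term vanishes.
  by_cases far : i + j < h ∨ h + j < i ∨ h + i < j
  · unfold racahOp
    simp only
    rw [sixjSq_eq_zero (h := h + 1) (by omega), sixjSq_eq_zero (h := h) (i := i) (by omega),
      sixjSq_eq_zero (h := h - 1) (by omega), sixjSq_eq_zero (i := i + 1) (by omega),
      sixjSq_eq_zero (i := i - 1) (by omega)]
    ring
  have u := upCoeff_mul_sixjSq (N := N) (h := h) (i := i) (j := j) (by omega) (by omega) (by omega)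
    (by omega)
  have d := downCoeff_mul_sixjSq (N := N) (h := h) (i := i) (j := j) (by omega) (by omega)
    (by omega) (by omega)
  have u' := upCoeff_mul_sixjSq (N := N) (h := i) (i := h) (j := j) (by omega) (by omega)
    (by omega) (by omega)
  have d' := downCoeff_mul_sixjSq (N := N) (h := i) (i := h) (j := j) (by omega) (by omega)
    (by omega) (by omega)
  have m := scaledSum_up_up (N := N) hh hi hj hiN hjN
  have m1 := scaledSum_down_up (N := N) (h := h) (by omega) hi hj hiN hjN
  have m2 := scaledSum_down_up (N := N) (h := i) (by omega) hh hj hhN hjN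
  rw [sixjSq_swap_left, sixjWeight_swap_left, scaledSum_swap_left] at u' d'
  rw [scaledSum_swap_left N h, scaledSum_swap_left N (h + 1), scaledSum_swap_left N h] at m2
  -- In the interior all denominators are positive.
  obtain ⟨a, ea⟩ : ∃ a : ℝ, a = i + j - h := ⟨_, rfl⟩
  obtain ⟨b, eb⟩ : ∃ b : ℝ, b = h + j - i := ⟨_, rfl⟩
  obtain ⟨c, ec⟩ : ∃ c : ℝ, c = h + i - j := ⟨_, rfl⟩
  have pa : 0 < a := by rw [ea]; exact_mod_cast (by omega : 0 < i + j - h)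
  have pb : 0 < b := by rw [eb]; exact_mod_cast (by omega : 0 < h + j - i)
  have pc : 0 < c := by rw [ec]; exact_mod_cast (by omega : 0 < h + i - j)
  have eh : (h : ℝ) = (b + c) / 2 := by rw [eb, ec]; ring
  have ei : (i : ℝ) = (a + c) / 2 := by rw [ea, ec]; ring
  have ej : (j : ℝ) = (a + b) / 2 := by rw [ea, eb]; ring
  unfold racahOp
  simp only
  rw [show 2 * (h : ℝ) + 1 = b + c + 1 by linarith, show (h : ℝ) + 1 + i - j = c + 1 by linarith,
    show (h : ℝ) + 1 - i + j = b + 1 by linarith, show (i : ℝ) + j - h = a by linarith,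
    show (i : ℝ) + j + h + 2 = a + b + c + 2 by linarith] at u
  rw [show 2 * (h : ℝ) + 1 = b + c + 1 by linarith, show (i : ℝ) + j + 1 - h = a + 1 by linarith,
    show (i : ℝ) + j + h + 1 = a + b + c + 1 by linarith, show (h : ℝ) + i - j = c by linarith,
    show (h : ℝ) - i + j = b by linarith] at d
  rw [show 2 * (i : ℝ) + 1 = a + c + 1 by linarith, show (i : ℝ) + 1 + h - j = c + 1 by linarith,
    show (i : ℝ) + 1 - h + j = a + 1 by linarith, show (h : ℝ) + j - i = b by linarith,
    show (h : ℝ) + j + i + 2 = a + b + c + 2 by linarith] at u'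
  rw [show 2 * (i : ℝ) + 1 = a + c + 1 by linarith, show (h : ℝ) + j + 1 - i = b + 1 by linarith,
    show (h : ℝ) + j + i + 1 = a + b + c + 1 by linarith, show (i : ℝ) + h - j = c by linarith,
    show (i : ℝ) - h + j = a by linarith] at d'
  rw [u, d, u', d']
  unfold sixjSq
  rw [eh, ei, ej] at m m1 m2
  rw [eh, ei]
  have key := interior_identity (x := scaledSum N (h + 1) i j) (x' := scaledSum N h (i + 1) j)
    (y := (((N : ℝ) + 1) ^ 2 - ((b + c) / 2) ^ 2) * scaledSum N (h - 1) i j)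
    (y' := (((N : ℝ) + 1) ^ 2 - ((a + c) / 2) ^ 2) * scaledSum N h (i - 1) j)
    (w := scaledSum N h i j) pa pb pc (by linear_combination m) (by linear_combination m1)
    (by linear_combination m2)
  calc _ = sixjWeight N h i j * _ := ?_
    _ = sixjWeight N h i j * _ := congrArg (sixjWeight N h i j * ·) key
    _ = _ := ?_
  · simp only [mul_add, mul_left_comm]
  · simp only [mul_add, mul_left_comm]

/-! ### Racah coefficients as finite sums -/

theorem fact_natCast (n : ℕ) : fact (n : ℝ) = (n.factorial : ℝ) := by simp [fact]

theorem poch_succ (x : ℝ) (n : ℕ) : poch x (n + 1) = poch x n * (x + n) := by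
  simp [poch, Finset.prod_range_succ]

theorem poch_neg_natCast (m n : ℕ) :
    poch (-(m : ℝ)) n = (-1) ^ n * (m.factorial : ℝ) * invFact ((m : ℤ) - n) := by
  induction n with
  | zero =>
    have : (m.factorial : ℝ) ≠ 0 := by positivity
    simp [poch, invFact_natCast, this]
  | succ n ih =>
    rw [poch_succ, ih, invFact_eq_mul (m := (m : ℤ) - ((n + 1 : ℕ) : ℤ)) (n := (m : ℤ) - n)
      (by push_cast; ring)]
    push_cast; ring

theorem poch_natCast_add_one (m n : ℕ) :
    poch ((m : ℝ) + 1) n = ((m + n).factorial : ℝ) / (m.factorial : ℝ) := by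
  have hm : (m.factorial : ℝ) ≠ 0 := by positivity
  induction n with
  | zero => simp [poch, hm]
  | succ n ih =>
    rw [poch_succ, ih, ← add_assoc, Nat.factorial_succ]
    push_cast; ring

/-- Reversing the summation, `t = β₁ - n`, turns the hypergeometric form into Racah's sum up to
sign. -/
theorem racahSeries_sq {K α₁ α₂ α₃ α₄ β₁ β₂ β₃ : ℕ} (s : ℝ) (h₁ : α₁ ≤ β₁) (h₂ : α₂ ≤ β₁)
    (h₃ : α₃ ≤ β₁) (h₄ : α₄ ≤ β₁) (hβ₂ : β₁ ≤ β₂) (hβ₃ : β₁ ≤ β₃) (hK : β₁ < K) :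
    racahSeries α₁ α₂ α₃ α₄ β₁ β₂ β₃ s ^ 2 = racahSum K α₁ α₂ α₃ α₄ β₁ β₂ β₃ ^ 2 := by
  have hsum : racahSum K α₁ α₂ α₃ α₄ β₁ β₂ β₃ =
      ∑ n ∈ Finset.range (β₁ + 1), racahTerm α₁ α₂ α₃ α₄ β₁ β₂ β₃ (β₁ - n) := by
    have := Finset.sum_range_reflect (racahTerm α₁ α₂ α₃ α₄ β₁ β₂ β₃) (β₁ + 1)
    simp only [add_tsub_cancel_right] at this
    rw [this]
    symm
    refine Finset.sum_subset (Finset.range_subset_range.mpr hK) fun t _ ht => racahTerm_eq_zero ?_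
    simp only [Finset.mem_range] at ht
    omega
  obtain ⟨m₁, rfl⟩ := Nat.exists_eq_add_of_le' h₁
  obtain ⟨m₂, e₂⟩ := Nat.exists_eq_add_of_le' h₂
  obtain ⟨m₃, e₃⟩ := Nat.exists_eq_add_of_le' h₃
  obtain ⟨m₄, e₄⟩ := Nat.exists_eq_add_of_le' h₄
  obtain ⟨n₂, rfl⟩ := Nat.exists_eq_add_of_le hβ₂
  obtain ⟨n₃, rfl⟩ := Nat.exists_eq_add_of_le hβ₃
  generalize hβ : m₁ + α₁ = β₁ at *
  have f₁ : (β₁ : ℝ) - α₁ = m₁ := by rw [← hβ]; push_cast; ring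
  have f₂ : (β₁ : ℝ) - α₂ = m₂ := by rw [e₂]; push_cast; ring
  have f₃ : (β₁ : ℝ) - α₃ = m₃ := by rw [e₃]; push_cast; ring
  have f₄ : (β₁ : ℝ) - α₄ = m₄ := by rw [e₄]; push_cast; ring
  have g₁ : (α₁ : ℝ) - β₁ = -m₁ := by rw [← f₁]; ring
  have g₂ : (α₂ : ℝ) - β₁ = -m₂ := by rw [← f₂]; ring
  have g₃ : (α₃ : ℝ) - β₁ = -m₃ := by rw [← f₃]; ring
  have g₄ : (α₄ : ℝ) - β₁ = -m₄ := by rw [← f₄]; ring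
  have k₁ : -(β₁ : ℝ) - 1 = -((β₁ + 1 : ℕ) : ℝ) := by push_cast; ring
  have k₂ : ((β₁ + n₂ : ℕ) : ℝ) - β₁ = n₂ := by push_cast; ring
  have k₃ : ((β₁ + n₃ : ℕ) : ℝ) - β₁ = n₃ := by push_cast; ring
  have k₄ : (β₁ : ℝ) + 1 = ((β₁ + 1 : ℕ) : ℝ) := by push_cast; ring
  have hε : ((-1 : ℝ) ^ (⌊(β₁ : ℝ) - s⌋ : ℤ)) ^ 2 = 1 := by
    rcases Int.even_or_odd ⌊(β₁ : ℝ) - s⌋ with h | h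
    · rw [h.neg_one_zpow]; norm_num
    · rw [h.neg_one_zpow]; norm_num
  have key : fact (β₁ + 1) / (fact ((β₁ + n₂ : ℕ) - β₁) * fact ((β₁ + n₃ : ℕ) - β₁) *
        fact (β₁ - α₁) * fact (β₁ - α₂) * fact (β₁ - α₃) * fact (β₁ - α₄)) *
      hyp4F3 (α₁ - β₁) (α₂ - β₁) (α₃ - β₁) (α₄ - β₁) (-β₁ - 1) ((β₁ + n₂ : ℕ) - β₁ + 1)
        ((β₁ + n₃ : ℕ) - β₁ + 1) 1 =
      (-1) ^ β₁ * racahSum K α₁ α₂ α₃ α₄ β₁ (β₁ + n₂ : ℕ) (β₁ + n₃ : ℕ) := by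
    unfold hyp4F3
    rw [hsum, f₁, f₂, f₃, f₄, g₁, g₂, g₃, g₄, k₁, k₂, k₃, k₄,
      tsum_eq_sum (s := Finset.range (β₁ + 1)), Finset.mul_sum, Finset.mul_sum]
    · refine Finset.sum_congr rfl fun n hn => ?_
      obtain ⟨t, ht⟩ := Nat.exists_eq_add_of_le' (Nat.lt_succ_iff.mp (Finset.mem_range.mp hn))
      have ht' : β₁ - n = t := by omega
      have i₁ : (t : ℤ) - α₁ = (m₁ : ℤ) - n := by omega
      have i₂ : (t : ℤ) - α₂ = (m₂ : ℤ) - n := by omega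
      have i₃ : (t : ℤ) - α₃ = (m₃ : ℤ) - n := by omega
      have i₄ : (t : ℤ) - α₄ = (m₄ : ℤ) - n := by omega
      have i₅ : (β₁ : ℤ) - t = (n : ℕ) := by omega
      have i₆ : ((β₁ + n₂ : ℕ) : ℤ) - t = ((n₂ + n : ℕ) : ℤ) := by omega
      have i₇ : ((β₁ + n₃ : ℕ) : ℤ) - t = ((n₃ + n : ℕ) : ℤ) := by omega
      have i₈ : ((β₁ + 1 : ℕ) : ℤ) - n = ((t + 1 : ℕ) : ℤ) := by omega
      rw [racahTerm, ht', i₁, i₂, i₃, i₄, i₅, i₆, i₇]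
      simp only [poch_neg_natCast, poch_natCast_add_one, fact_natCast, i₈, invFact_natCast, one_pow]
      -- The five signs `(-1)^n` of the Pochhammer symbols and the sign `(-1)^t` of `racahTerm`
      -- combine to `(-1)^β₁`.
      have s1 : (-1 : ℝ) ^ β₁ = (-1) ^ t * (-1) ^ n := by rw [ht, pow_add]
      have s2 : (-1 : ℝ) ^ t * (-1) ^ t = 1 := by rw [← mul_pow]; norm_num
      have s3 : (-1 : ℝ) ^ n * (-1) ^ n = 1 := by rw [← mul_pow]; norm_num
      have q : (-1 : ℝ) ^ n ≠ 0 := by positivity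
      rw [s1]
      field_simp
      have s4 : ((-1 : ℝ) ^ n) ^ 2 = 1 := by rw [sq, s3]
      have s5 : ((-1 : ℝ) ^ t) ^ 2 = 1 := by rw [sq, s2]
      simp [s4, s5]
    · intro n hn
      rw [poch_neg_natCast m₁, invFact_of_neg (n := (m₁ : ℤ) - n)]
      · ring
      · simp only [Finset.mem_range] at hn
        omega
  have : racahSeries α₁ α₂ α₃ α₄ β₁ (β₁ + n₂ : ℕ) (β₁ + n₃ : ℕ) s =
      (-1 : ℝ) ^ (⌊(β₁ : ℝ) - s⌋ : ℤ) *
        ((-1) ^ β₁ * racahSum K α₁ α₂ α₃ α₄ β₁ (β₁ + n₂ : ℕ) (β₁ + n₃ : ℕ)) := by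
    rw [← key]; unfold racahSeries; ring
  have s2 : ((-1 : ℝ) ^ β₁) ^ 2 = 1 := by rw [← pow_mul, mul_comm, pow_mul]; norm_num
  rw [this, mul_pow, mul_pow, hε, s2]; ring

theorem triangleCoeff_sq {x y z : ℝ} {p q r s : ℕ} (hp : x + y - z = p) (hq : y + z - x = q)
    (hr : z + x - y = r) (hs : x + y + z + 1 = s) :
    triangleCoeff x y z ^ 2 = (p.factorial * q.factorial * r.factorial / s.factorial : ℝ) := by
  unfold triangleCoeff
  rw [hp, hq, hr, hs, Real.sq_sqrt]
  · simp only [fact_natCast]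
  · simp only [fact_natCast]; positivity

theorem racahSum_eq_sixjSum (N h i j : ℕ) :
    racahSum (4 * N + 4) (N + j : ℕ) (i + h + j : ℕ) (N + i : ℕ) (N + h : ℕ)
      (N + i + h : ℕ) (N + h + j : ℕ) (N + i + j : ℕ) = sixjSum N h i j := by
  unfold sixjSum racahSum racahTerm
  refine Finset.sum_congr rfl fun t _ => ?_
  push_cast
  rw [show (i : ℤ) + h + j = h + i + j by ring, show (N : ℤ) + i + h = N + h + i by ring]
  ring

theorem racahSum_swap₁₂ (K : ℕ) (α₁ α₂ α₃ α₄ β₁ β₂ β₃ : ℤ) :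
    racahSum K α₁ α₂ α₃ α₄ β₂ β₁ β₃ = racahSum K α₁ α₂ α₃ α₄ β₁ β₂ β₃ := by
  unfold racahSum racahTerm
  refine Finset.sum_congr rfl fun t _ => ?_
  ring

theorem racahSum_swap₂₃ (K : ℕ) (α₁ α₂ α₃ α₄ β₁ β₂ β₃ : ℤ) :
    racahSum K α₁ α₂ α₃ α₄ β₁ β₃ β₂ = racahSum K α₁ α₂ α₃ α₄ β₁ β₂ β₃ := by
  unfold racahSum racahTerm
  refine Finset.sum_congr rfl fun t _ => ?_
  ring

theorem admissible_half {N j : ℕ} (hj : j ≤ N) :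
    Admissible ((N : ℝ) / 2) ((N : ℝ) / 2) (j : ℝ) ∧
      Admissible ((N : ℝ) / 2) (j : ℝ) ((N : ℝ) / 2) := by
  have h1 : IsHalfNat ((N : ℝ) / 2) := ⟨N, rfl⟩
  have h2 : IsHalfNat (j : ℝ) := ⟨2 * j, by push_cast; ring⟩
  have h3 : (j : ℝ) ≤ N := by exact_mod_cast hj
  have h4 : (0 : ℝ) ≤ j := by positivity
  refine ⟨⟨⟨h1, h1, h2⟩, ⟨N + j, by push_cast; ring⟩, ?_, ?_, ?_⟩,
    ⟨⟨h1, h2, h1⟩, ⟨N + j, by push_cast; ring⟩, ?_, ?_, ?_⟩⟩ <;> linarith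

theorem admissible_natCast {h i j : ℕ} :
    Admissible (i : ℝ) (h : ℝ) (j : ℝ) ↔ i ≤ h + j ∧ h ≤ i + j ∧ j ≤ h + i := by
  have hn (n : ℕ) : IsHalfNat (n : ℝ) := ⟨2 * n, by push_cast; ring⟩
  constructor
  · rintro ⟨-, -, h1, h2, h3⟩
    norm_cast at h1 h2 h3
    omega
  · rintro ⟨h1, h2, h3⟩
    refine ⟨⟨hn _, hn _, hn _⟩, ⟨i + h + j, by push_cast; ring⟩, ?_, ?_, ?_⟩ <;>
      norm_cast <;> omega

/-- The squared Racah coefficient of the statement is `sixjSq`. -/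
theorem W_sq {N h i j : ℕ} (hh : h ≤ N) (hi : i ≤ N) (hj : j ≤ N) :
    W ((N : ℝ) / 2) ((N : ℝ) / 2) i h j ((N : ℝ) / 2) ^ 2 = sixjSq N h i j := by
  by_cases tri : i ≤ h + j ∧ h ≤ i + j ∧ j ≤ h + i
  swap
  · rw [sixjSq_eq_zero (by omega)]
    unfold W
    rw [if_neg fun H => tri (admissible_natCast.mp H.2.1)]
    norm_num
  have H := And.intro (admissible_half hj).1 (And.intro (admissible_natCast.mpr tri)
    (And.intro (admissible_half hi).2 (admissible_half hh).2))
  obtain ⟨t1, t2, t3⟩ := tri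
  have a1 : (N : ℝ) / 2 + N / 2 + j = (N + j : ℕ) := by push_cast; ring
  have a2 : (i : ℝ) + h + j = (i + h + j : ℕ) := by push_cast; ring
  have a3 : (N : ℝ) / 2 + i + N / 2 = (N + i : ℕ) := by push_cast; ring
  have a4 : (N : ℝ) / 2 + h + N / 2 = (N + h : ℕ) := by push_cast; ring
  have b1 : (N : ℝ) / 2 + N / 2 + i + h = (N + i + h : ℕ) := by push_cast; ring
  have b2 : (N : ℝ) / 2 + h + j + N / 2 = (N + h + j : ℕ) := by push_cast; ring
  have b3 : (N : ℝ) / 2 + i + j + N / 2 = (N + i + j : ℕ) := by push_cast; ring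
  have c1 := triangleCoeff_sq (x := (N : ℝ) / 2) (y := (N : ℝ) / 2) (z := j) (p := N - j) (q := j)
    (r := j) (s := N + j + 1) (by push_cast [hj]; ring) (by ring) (by ring) (by push_cast; ring)
  have c2 := triangleCoeff_sq (x := (i : ℝ)) (y := (h : ℝ)) (z := j) (p := h + i - j)
    (q := h + j - i) (r := i + j - h) (s := h + i + j + 1) (by push_cast [t3]; ring)
    (by push_cast [t1]; ring) (by push_cast [t2]; ring) (by push_cast; ring)
  have c3 := triangleCoeff_sq (x := (N : ℝ) / 2) (y := i) (z := (N : ℝ) / 2) (p := i) (q := i)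
    (r := N - i) (s := N + i + 1) (by ring) (by ring) (by push_cast [hi]; ring) (by push_cast; ring)
  have c4 := triangleCoeff_sq (x := (N : ℝ) / 2) (y := h) (z := (N : ℝ) / 2) (p := h) (q := h)
    (r := N - h) (s := N + h + 1) (by ring) (by ring) (by push_cast [hh]; ring) (by push_cast; ring)
  unfold W
  rw [if_pos H]
  simp only
  rw [a1, a2, a3, a4, b1, b2, b3, mul_pow, mul_pow, mul_pow, mul_pow, c1, c2, c3, c4]
  -- Whichever of the three `β` is smallest, the series is the same Racah sum up to sign.
  have R : ∀ x y z : ℝ, ((x = (N + i + h : ℕ)) ∧ (y = (N + h + j : ℕ)) ∧ (z = (N + i + j : ℕ))) →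
      (if x ≤ y ∧ x ≤ z then
        racahSeries (N + j : ℕ) (i + h + j : ℕ) (N + i : ℕ) (N + h : ℕ) x y z x
      else if y ≤ z then
        racahSeries (N + j : ℕ) (i + h + j : ℕ) (N + i : ℕ) (N + h : ℕ) y x z x
      else racahSeries (N + j : ℕ) (i + h + j : ℕ) (N + i : ℕ) (N + h : ℕ) z x y x) ^ 2 =
        sixjSum N h i j ^ 2 := by
    rintro _ _ _ ⟨rfl, rfl, rfl⟩
    split_ifs with h1 h2
    · rw [Nat.cast_le, Nat.cast_le] at h1
      rw [racahSeries_sq (K := 4 * N + 4) _ (by omega) (by omega) (by omega) (by omega) (by omega)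
        (by omega) (by omega), racahSum_eq_sixjSum]
    · rw [Nat.cast_le, Nat.cast_le] at h1
      rw [Nat.cast_le] at h2
      rw [racahSeries_sq (K := 4 * N + 4) _ (by omega) (by omega) (by omega) (by omega) (by omega)
        (by omega) (by omega), racahSum_swap₁₂, racahSum_eq_sixjSum]
    · rw [Nat.cast_le, Nat.cast_le] at h1
      rw [Nat.cast_le] at h2
      rw [racahSeries_sq (K := 4 * N + 4) _ (by omega) (by omega) (by omega) (by omega) (by omega)
        (by omega) (by omega), racahSum_swap₁₂, racahSum_swap₂₃, racahSum_eq_sixjSum]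
  rw [R _ _ _ ⟨rfl, rfl, rfl⟩]
  unfold sixjSq scaledSum sixjWeight sideWeight
  rw [show (i : ℤ) + j - h = (i + j - h : ℕ) by omega, show (h : ℤ) + j - i = (h + j - i : ℕ) by omega,
    show (h : ℤ) + i - j = (h + i - j : ℕ) by omega, show (h : ℤ) + i + j + 1 = (h + i + j + 1 : ℕ) by
    omega, show (N : ℤ) - h = (N - h : ℕ) by omega, show (N : ℤ) - i = (N - i : ℕ) by omega,
    show (N : ℤ) - j = (N - j : ℕ) by omega, show (N : ℤ) + h + 1 = (N + h + 1 : ℕ) by omega,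
    show (N : ℤ) + i + 1 = (N + i + 1 : ℕ) by omega, show (N : ℤ) + j + 1 = (N + j + 1 : ℕ) by omega]
  simp only [intFact_natCast, invFact_natCast]
  ring

/-! ### The matrices `u_i(A)` -/

theorem a_eq (D h : ℕ) : a D h = 3 / (D * (D + 2)) * (((h : ℤ) : ℝ) * ((h : ℤ) + 1)) := by
  unfold a; push_cast; ring

theorem b_eq (D h : ℕ) : b D h = 3 / (D * (D + 2)) * upCoeff D h := by
  unfold b upCoeff; push_cast
  rw [div_mul_div_comm]
  congr 1; ring

theorem c_eq (D h : ℕ) : c D h = 3 / (D * (D + 2)) * downCoeff D h := by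
  unfold c downCoeff; push_cast
  rw [div_mul_div_comm]
  congr 1; ring

/-- Left multiplication by `A` is the difference operator `racahOp` in the row index. -/
theorem A_mul_apply {D : ℕ} (M : Matrix (Fin (D + 1)) (Fin (D + 1)) ℝ) (φ : ℤ → ℝ)
    (h j : Fin (D + 1)) (hφ : ∀ x : Fin (D + 1), M x j = φ ((x : ℕ) : ℤ)) :
    (A D * M) h j = 3 / (D * (D + 2)) * racahOp D φ ((h : ℕ) : ℤ) := by
  obtain ⟨h, hh⟩ := h
  rw [Matrix.mul_apply]
  have e : ∀ x : Fin (D + 1), A D ⟨h, hh⟩ x * M x j =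
      (fun m : ℕ => (if m = h then a D h * φ (h : ℤ) else 0) +
        (if m = h + 1 then b D h * φ ((h : ℤ) + 1) else 0) +
        (if m + 1 = h then c D h * φ ((h : ℤ) - 1) else 0)) (x : ℕ) := by
    intro x
    rw [hφ]
    simp only [A, Matrix.of_apply]
    split_ifs with h1 _ _ _ h5 <;> first | omega | skip
    · simp [h1]
    · simp [h5]
    · have : (h : ℤ) - 1 = (x : ℕ) := by omega
      simp [this]
    · simp
  rw [Finset.sum_congr rfl fun x _ => e x, Fin.sum_univ_eq_sum_range
    (fun m : ℕ => (if m = h then a D h * φ (h : ℤ) else 0) +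
        (if m = h + 1 then b D h * φ ((h : ℤ) + 1) else 0) +
        (if m + 1 = h then c D h * φ ((h : ℤ) - 1) else 0)) (D + 1),
    Finset.sum_add_distrib, Finset.sum_add_distrib]
  have s1 : ∑ m ∈ Finset.range (D + 1), (if m = h then a D h * φ (h : ℤ) else 0) =
      a D h * φ (h : ℤ) := by
    rw [Finset.sum_ite_eq', if_pos (Finset.mem_range.mpr hh)]
  have s2 : ∑ m ∈ Finset.range (D + 1), (if m = h + 1 then b D h * φ ((h : ℤ) + 1) else 0) =
      b D h * φ ((h : ℤ) + 1) := by
    rw [Finset.sum_ite_eq']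
    split_ifs with hm
    · rfl
    · have : h = D := by simp only [Finset.mem_range] at hm; omega
      subst this
      simp [b]
  have s3 : ∑ m ∈ Finset.range (D + 1), (if m + 1 = h then c D h * φ ((h : ℤ) - 1) else 0) =
      c D h * φ ((h : ℤ) - 1) := by
    rcases h with _ | h
    · simp [c]
    · simp only [Nat.add_right_cancel_iff]
      rw [Finset.sum_ite_eq', if_pos (Finset.mem_range.mpr (by omega))]
  rw [s1, s2, s3, a_eq, b_eq, c_eq]
  unfold racahOp
  ring

theorem racahOp_const_mul (N : ℕ) (r : ℝ) (φ : ℤ → ℝ) (h : ℤ) :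
    racahOp N (fun x => r * φ x) h = r * racahOp N φ h := by
  unfold racahOp; ring

theorem sixjSum_zero_middle {N h : ℕ} (hN : h ≤ N) :
    sixjSum N h 0 h = (-1) ^ (N + h) * ((N + h + 1).factorial : ℝ) *
      (invFact (N - h) * invFact h ^ 2) := by
  unfold sixjSum racahSum
  rw [Finset.sum_eq_single (N + h)]
  · unfold racahTerm
    push_cast
    rw [show (N : ℤ) + h - (h + 0 + h) = N - h by ring, show (N : ℤ) + h - (N + h) = 0 by ring,
      show (N : ℤ) + h - (N + 0) = h by ring, show (N : ℤ) + h + 0 - (N + h) = 0 by ring,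
      show (N : ℤ) + h + h - (N + h) = h by ring, show (N : ℤ) + 0 + h - (N + h) = 0 by ring,
      invFact_zero]
    ring
  · intro t _ ht
    exact racahTerm_eq_zero (by omega)
  · intro ht
    simp only [Finset.mem_range] at ht
    omega

theorem sixjSq_zero_middle {N h : ℕ} (hN : h ≤ N) :
    (2 * (h : ℝ) + 1) * (N + 1) * sixjSq N h 0 h = 1 := by
  have e1 : intFact ((N : ℤ) - h) * invFact (N - h) = 1 := by
    rw [mul_comm]; exact invFact_mul_intFact (by omega)
  have e2 : invFact ((N : ℤ) + h + 1) * ((N + h + 1).factorial : ℝ) = 1 := by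
    rw [← intFact_natCast]; push_cast; exact invFact_mul_intFact (by omega)
  have e3 : intFact (h : ℤ) * invFact h = 1 := by
    rw [mul_comm]; exact invFact_mul_intFact (by omega)
  have e4 : (2 * (h : ℝ) + 1) * (intFact ((h : ℤ) + h) * invFact ((h : ℤ) + h + 1)) = 1 := by
    have := invFact_mul_intFact (n := (h : ℤ) + h + 1) (by omega)
    rw [intFact_add_one (n := (h : ℤ) + h) (by omega)] at this
    push_cast at this
    linear_combination this
  have e5 : ((N : ℝ) + 1) * (intFact (N : ℤ) * invFact ((N : ℤ) + 1)) = 1 := by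
    have := invFact_mul_intFact (n := (N : ℤ) + 1) (by omega)
    rw [intFact_add_one (n := (N : ℤ)) (by omega)] at this
    push_cast at this
    linear_combination this
  have e6 : ((-1 : ℝ) ^ (N + h)) ^ 2 = 1 := by rw [← pow_mul, mul_comm, pow_mul]; norm_num
  unfold sixjSq scaledSum sixjWeight sideWeight
  rw [sixjSum_zero_middle hN]
  simp only [zero_add, add_zero, sub_zero, sub_self, intFact_zero]
  calc _ = ((2 * (h : ℝ) + 1) * (intFact ((h : ℤ) + h) * invFact ((h : ℤ) + h + 1))) *
        (((N : ℝ) + 1) * (intFact (N : ℤ) * invFact ((N : ℤ) + 1))) *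
        (intFact ((N : ℤ) - h) * invFact (N - h)) ^ 2 *
        (invFact ((N : ℤ) + h + 1) * ((N + h + 1).factorial : ℝ)) ^ 2 *
        (intFact (h : ℤ) * invFact h) ^ 4 * ((-1 : ℝ) ^ (N + h)) ^ 2 := by ring
    _ = 1 := by rw [e1, e2, e3, e4, e5, e6]; ring

theorem b_mul_div_c {D i : ℕ} (hi : i < D) :
    b D i / c D (i + 1) = (2 * ((i : ℝ) + 1) + 1) / (2 * i + 1) := by
  have h1 : (0 : ℝ) < D - i := by
    have : (i : ℝ) < D := by exact_mod_cast hi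
    linarith
  have h2 : (0 : ℝ) < D := by exact_mod_cast (by omega : 0 < D)
  have h3 : (D : ℝ) - (i + 1) + 1 = D - i := by ring
  unfold b c
  push_cast
  rw [h3]
  field_simp
  ring

theorem k_eq {D i : ℕ} (hi : i ≤ D) : k D i = 2 * (i : ℝ) + 1 := by
  induction i with
  | zero => simp [k]
  | succ i ih =>
    have e : k D (i + 1) = k D i * (b D i / c D (i + 1)) := by
      unfold k
      rw [Finset.prod_range_succ, Finset.prod_Icc_succ_top (by omega), mul_div_mul_comm]
    rw [e, ih (by omega), b_mul_div_c (by omega)]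
    have : (2 * (i : ℝ) + 1) ≠ 0 := by positivity
    push_cast
    field_simp

theorem b_pos {D i : ℕ} (hi : i < D) : 0 < b D i := by
  have h1 : (0 : ℝ) < D - i := by
    have : (i : ℝ) < D := by exact_mod_cast hi
    linarith
  have h2 : (0 : ℝ) < D := by exact_mod_cast (by omega : 0 < D)
  unfold b
  positivity

/-- The three-term recurrence of the matrices `u_i(A)`, solved for the leading one. -/
theorem aeval_u_add_two (D n : ℕ) : aeval (A D) (u D (n + 2)) =
    (b D (n + 1))⁻¹ • (A D * aeval (A D) (u D (n + 1)) - a D (n + 1) • aeval (A D) (u D (n + 1))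
      - c D (n + 1) • aeval (A D) (u D n)) := by
  simp only [u, map_mul, map_sub, aeval_C, aeval_X, ← Algebra.smul_def]

theorem aeval_u_zero_apply {D : ℕ} (h j : Fin (D + 1)) : aeval (A D) (u D 0) h j =
    (2 * ((j : ℕ) : ℝ) + 1) * ((D : ℝ) + 1) * sixjSq D ((h : ℕ) : ℤ) ((0 : ℕ) : ℤ) ((j : ℕ) : ℤ) := by
  have hh := h.isLt
  simp only [u, map_one, Matrix.one_apply, Nat.cast_zero]
  split_ifs with e
  · rw [e, sixjSq_zero_middle (by omega)]
  · have : (h : ℕ) ≠ j := fun e' => e (Fin.ext e')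
    rw [sixjSq_eq_zero (by omega), mul_zero]

/-- The entries of `u_i(A)`: both sides satisfy the recurrence of the `u_i`, by the difference
equation for the squared `6j`-symbol. -/
theorem aeval_u_apply {D : ℕ} (hD : 1 ≤ D) : ∀ (i : ℕ), i ≤ D → ∀ h j : Fin (D + 1),
    aeval (A D) (u D i) h j =
      (2 * ((j : ℕ) : ℝ) + 1) * ((D : ℝ) + 1) * sixjSq D ((h : ℕ) : ℤ) (i : ℤ) ((j : ℕ) : ℤ) := by
  have step : ∀ (i : ℕ), i < D → (∀ h j : Fin (D + 1), aeval (A D) (u D i) h j =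
      (2 * ((j : ℕ) : ℝ) + 1) * ((D : ℝ) + 1) * sixjSq D ((h : ℕ) : ℤ) i ((j : ℕ) : ℤ)) →
      ∀ h j : Fin (D + 1), (A D * aeval (A D) (u D i)) h j =
        (2 * ((j : ℕ) : ℝ) + 1) * ((D : ℝ) + 1) * (b D i * sixjSq D ((h : ℕ) : ℤ) (i + 1) ((j : ℕ) : ℤ)
          + a D i * sixjSq D ((h : ℕ) : ℤ) i ((j : ℕ) : ℤ)
          + c D i * sixjSq D ((h : ℕ) : ℤ) (i - 1) ((j : ℕ) : ℤ)) := by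
    intro i hi ih h j
    have hh := h.isLt
    have hj := j.isLt
    rw [A_mul_apply _ (fun x => (2 * ((j : ℕ) : ℝ) + 1) * ((D : ℝ) + 1) *
        sixjSq D x i ((j : ℕ) : ℤ)) h j (fun x => ih x j), racahOp_const_mul,
      racahOp_sixjSq (by omega) (by omega) (by omega) (by omega) (by omega) (by omega),
      a_eq, b_eq, c_eq]
    unfold racahOp
    ring
  intro i
  induction i using Nat.twoStepInduction with
  | zero => exact fun _ => aeval_u_zero_apply
  | one =>
    intro _ h j
    have e0 : aeval (A D) (u D 0) = 1 := by simp [u]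
    have s := step 0 (by omega) aeval_u_zero_apply h j
    rw [e0, mul_one] at s
    have hD' : (0 : ℝ) < D := by exact_mod_cast hD
    have e1 : b D 0 = 3 := by unfold b; field_simp; push_cast; ring
    have e2 : a D 0 = 0 := by simp [a]
    have e3 : c D 0 = 0 := by simp [c]
    have e4 : aeval (A D) (u D 1) = (1 / 3 : ℝ) • A D := by
      simp only [u, map_mul, aeval_C, aeval_X, ← Algebra.smul_def]
    rw [e4, Matrix.smul_apply, s, e1, e2, e3]
    simp only [smul_eq_mul, Nat.cast_zero, zero_add, Nat.cast_one]
    ring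
  | more n ih1 ih2 =>
    intro hn h j
    have s := step (n + 1) (by omega) (ih2 (by omega)) h j
    have hb := (b_pos (D := D) (i := n + 1) (by omega)).ne'
    rw [aeval_u_add_two, Matrix.smul_apply, Matrix.sub_apply, Matrix.sub_apply, Matrix.smul_apply,
      Matrix.smul_apply, s, ih1 (by omega), ih2 (by omega)]
    rw [show (((n + 1 : ℕ) : ℤ) - 1) = n by push_cast; ring,
      show (((n + 1 : ℕ) : ℤ) + 1) = ((n + 2 : ℕ) : ℤ) by push_cast; ring]
    simp only [smul_eq_mul]
    field_simp
    ring

end KreschTamvakis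

end

theorem corollary5p8 (D : ℕ) (hD : 1 ≤ D) :
    (∀ h i j : Fin (D + 1),
      KreschTamvakis.p D h i j =
        (2 * ((i : ℕ) : ℝ) + 1) * (2 * ((j : ℕ) : ℝ) + 1) * ((D : ℝ) + 1) *
          (KreschTamvakis.W ((D : ℝ) / 2) ((D : ℝ) / 2) ((i : ℕ) : ℝ) ((h : ℕ) : ℝ)
            ((j : ℕ) : ℝ) ((D : ℝ) / 2)) ^ 2) ∧
    (∀ i h j : Fin (D + 1), 0 ≤ KreschTamvakis.B D i h j) := by
  have key : ∀ h i j : Fin (D + 1),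
      KreschTamvakis.p D h i j =
        (2 * ((i : ℕ) : ℝ) + 1) * (2 * ((j : ℕ) : ℝ) + 1) * ((D : ℝ) + 1) *
          (KreschTamvakis.W ((D : ℝ) / 2) ((D : ℝ) / 2) ((i : ℕ) : ℝ) ((h : ℕ) : ℝ)
            ((j : ℕ) : ℝ) ((D : ℝ) / 2)) ^ 2 := by
    intro h i j
    have hh := h.isLt
    have hi := i.isLt
    have hj := j.isLt
    rw [KreschTamvakis.W_sq (by omega) (by omega) (by omega), KreschTamvakis.p, KreschTamvakis.B,
      KreschTamvakis.v, map_mul, aeval_C, ← Algebra.smul_def, Matrix.smul_apply,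
      KreschTamvakis.aeval_u_apply hD i (by omega), KreschTamvakis.k_eq (by omega), smul_eq_mul]
    ring
  refine ⟨key, fun i h j => ?_⟩
  have := key h i j
  rw [KreschTamvakis.p] at this
  rw [this]
  positivity
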